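/- Let $r,n,d$ be positive integers with $r\ge n$. Let $\mathcal F_{r,n}\subset\mathbb C^{n\times r}$ be the set of all complex $n\times r$ matrices $V=(v_{ij})$ satisfying $$V V^{T}=\tfrac{r}{n}\,\mathrm{Id}_n\qquad\text{and}\qquad \sum_{i=1}^n v_{ij}^2=1\quad\text{for } j=1,\dots,r,$$ and write $\mathbf v_1,\dots,\mathbf v_r\in\mathbb C^n$ for the columns of $V$. Let $\mathcal T_{r,n,d}$ be the Zariski closure in the complex projective space $\mathbb P(\mathrm{Sym}_d(\mathbb C^n))$ of the set of points represented by the nonzero symmetric tensors $$\sum_{j=1}^r\lambda_j\,\mathbf v_j^{\otimes d},\qquad V\in\mathcal F_{r,n},\ \lambda_1,\dots,\lambda_r\in\mathbb C .$$ **Proposition.** For all $r>n\ge 1$ and $d\ge 3$, $$\dim \mathcal T_{r,n,d}\ \le\ \min\left\{(n-1)(r-n)+\frac{(n-1)(n-2)}{2}+r-1,\ \binom{n+d-1}{d}-1\right\}.$$ -/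

import Mathlib

open scoped LinearAlgebra.Projectivization

noncomputable section

namespace Fradeco

/-- The common zeros in complex projective space (with homogeneous coordinates indexed by `ι`) of
a set `S` of polynomials. It is only used for sets of homogeneous polynomials, for which the choice
of the representative `p.rep` of `p` does not matter. -/
def projZeroLocus (ι : Type) (S : Set (MvPolynomial ι ℂ)) : Set (ℙ ℂ (ι → ℂ)) :=
  {p | ∀ f ∈ S, MvPolynomial.eval p.rep f = 0}

/-- Whether a homogeneous polynomial vanishes at a point of projective space does not depend on
the chosen representative. -/
theorem eval_rep_eq_zero_iff {ι : Type} {f : MvPolynomial ι ℂ} {m : ℕ} (hf : f.IsHomogeneous m)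
    (w : ι → ℂ) (hw : w ≠ 0) :
    MvPolynomial.eval (Projectivization.mk ℂ w hw).rep f = 0 ↔ MvPolynomial.eval w f = 0 := by
  obtain ⟨a, ha⟩ := Projectivization.exists_smul_eq_mk_rep ℂ w hw
  have h : MvPolynomial.eval (a • w) f = (a : ℂ) ^ m * MvPolynomial.eval w f :=
    by
    rw [MvPolynomial.eval_eq, MvPolynomial.eval_eq, Finset.mul_sum]
    refine Finset.sum_congr rfl fun e he => ?_
    have hm : e.degree = m := by
      by_contra hne
      exact (MvPolynomial.mem_support_iff.mp he) (hf.coeff_eq_zero hne)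
    have hprod : ∏ i ∈ e.support, (a • w) i ^ e i = (a : ℂ) ^ m * ∏ i ∈ e.support, w i ^ e i := by
      rw [← hm, Finsupp.degree_apply, ← Finset.prod_pow_eq_pow_sum, ← Finset.prod_mul_distrib]
      exact Finset.prod_congr rfl fun i _ => mul_pow (a : ℂ) (w i) (e i)
    rw [hprod]
    ring
  rw [← ha, h]
  simp

/-- A subset of projective space is an algebraic set if it is the common zero locus of a set of
homogeneous polynomials. -/
def IsProjAlgebraic (ι : Type) (Z : Set (ℙ ℂ (ι → ℂ))) : Prop :=
  ∃ S : Set (MvPolynomial ι ℂ), (∀ f ∈ S, ∃ m, f.IsHomogeneous m) ∧ Z = projZeroLocus ι S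

/-- The Zariski topology on complex projective space: the closed sets are the algebraic sets. -/
@[reducible] def zariski (ι : Type) : TopologicalSpace (ℙ ℂ (ι → ℂ)) :=
  TopologicalSpace.ofClosed {Z | IsProjAlgebraic ι Z}
    (by
      refine ⟨{1}, ?_, ?_⟩
      · rintro f rfl
        exact ⟨0, MvPolynomial.isHomogeneous_one ι ℂ⟩
      · ext p
        simp [projZeroLocus])
    (by
      intro A hA
      refine ⟨{f | (∃ m, f.IsHomogeneous m) ∧
        ∃ Z ∈ A, ∀ p ∈ Z, MvPolynomial.eval p.rep f = 0}, fun f hf => hf.1, ?_⟩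
      ext p
      constructor
      · rintro hp f ⟨-, Z, hZ, hf⟩
        exact hf p (hp Z hZ)
      · intro hp Z hZ
        obtain ⟨S, hS, rfl⟩ := hA hZ
        intro f hf
        exact hp f ⟨hS f hf, _, hZ, fun q hq => hq f hf⟩)
    (by
      rintro _ ⟨S, hS, rfl⟩ _ ⟨S', hS', rfl⟩
      refine ⟨{h | ∃ f ∈ S, ∃ g ∈ S', h = f * g}, ?_, ?_⟩
      · rintro _ ⟨f, hf, g, hg, rfl⟩
        obtain ⟨a, ha⟩ := hS f hf
        obtain ⟨b, hb⟩ := hS' g hg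
        exact ⟨a + b, ha.mul hb⟩
      · ext p
        constructor
        · rintro (hp | hp) _ ⟨f, hf, g, hg, rfl⟩
          · simp [hp f hf]
          · simp [hp g hg]
        · intro hp
          by_contra hcon
          simp only [Set.mem_union, not_or] at hcon
          obtain ⟨h1, h2⟩ := hcon
          simp only [projZeroLocus, Set.mem_ofPred_eq, not_forall] at h1 h2
          obtain ⟨f, hf, hf0⟩ := h1
          obtain ⟨g, hg, hg0⟩ := h2
          have := hp (f * g) ⟨f, hf, g, hg, rfl⟩
          rw [map_mul] at this
          exact (mul_ne_zero hf0 hg0) this)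

/-- The closed sets of the Zariski topology are exactly the algebraic sets. -/
theorem isClosed_zariski_iff {ι : Type} {Z : Set (ℙ ℂ (ι → ℂ))} :
    @IsClosed _ (zariski ι) Z ↔ IsProjAlgebraic ι Z := by
  rw [← @isOpen_compl_iff _ _ (zariski ι)]
  change Zᶜᶜ ∈ {Z | IsProjAlgebraic ι Z} ↔ _
  rw [compl_compl, Set.mem_ofPred_eq]

/-- The Zariski closure of a subset of projective space. -/
def zariskiClosure (ι : Type) (Z : Set (ℙ ℂ (ι → ℂ))) : Set (ℙ ℂ (ι → ℂ)) :=
  @closure _ (zariski ι) Z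

/-- The dimension of a subset of projective space: the supremum of the lengths of chains of
irreducible closed subsets in its (subspace) Zariski topology, and `⊥` for the empty set. -/
def zariskiDim (ι : Type) (Z : Set (ℙ ℂ (ι → ℂ))) : WithBot ℕ∞ :=
  letI : TopologicalSpace (ℙ ℂ (ι → ℂ)) := zariski ι
  topologicalKrullDim Z

/-- The space `Sym_d(ℂⁿ)` of symmetric `n × ⋯ × n` tensors `T = (t_{i₁ ⋯ i_d})`. As a symmetric
tensor, `T` is given by its entries `t_s`, one for each multiset `s = {i₁, …, i_d}` of size `d` of
indices in `{1, …, n}`; there are `binom (n + d - 1) d` of them. -/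
abbrev SymTensor (n d : ℕ) : Type := Sym (Fin n) d → ℂ

/-- The symmetric tensor `∑ j, λ_j v_j^{⊗ d}`, where `v_1, …, v_r` are the columns of `V`. Its
entry in position `(i₁, …, i_d)` is `∑ j, λ_j v_{i₁ j} ⋯ v_{i_d j}`. -/
def decomposedTensor {r n : ℕ} (d : ℕ) (V : Matrix (Fin n) (Fin r) ℂ) (lam : Fin r → ℂ) :
    SymTensor n d :=
  fun s => ∑ j, lam j * ((s : Multiset (Fin n)).map fun i => V i j).prod

/-- The funtf variety: all complex `n × r` matrices `V` with `V Vᵀ = (r / n) Id` whose columns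
`v_j` satisfy `∑ i, v_{ij}² = 1`. -/
def funtfVariety (r n : ℕ) : Set (Matrix (Fin n) (Fin r) ℂ) :=
  {V | V * V.transpose = ((r : ℂ) / (n : ℂ)) • (1 : Matrix (Fin n) (Fin n) ℂ) ∧
    ∀ j, ∑ i, V i j ^ 2 = 1}

/-- The points of `ℙ(Sym_d(ℂⁿ))` represented by the nonzero tensors `∑ j, λ_j v_j^{⊗ d}` with
`(v_1, …, v_r)` in the funtf variety and `λ_1, …, λ_r` complex numbers. -/
def frameDecomposable (r n d : ℕ) : Set (ℙ ℂ (SymTensor n d)) :=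
  {p | ∃ V ∈ funtfVariety r n, ∃ lam : Fin r → ℂ, ∃ h : decomposedTensor d V lam ≠ 0,
    p = Projectivization.mk ℂ (decomposedTensor d V lam) h}

/-- The fradeco variety: the Zariski closure of the set of frame decomposable tensors. -/
def fradecoVariety (r n d : ℕ) : Set (ℙ ℂ (SymTensor n d)) :=
  zariskiClosure (Sym (Fin n) d) (frameDecomposable r n d)

end Fradeco

end

/-!
The bound by the dimension of the ambient projective space follows from the dimension of a polynomial
ring. For the other bound, a chain of irreducible closed subsets of the fradeco variety gives a chain
of prime ideals of their affine cones, ending in the ideal of the origin. All these primes contain the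
pullback `q` of a minimal prime `p` over the ideal of the funtf equations in the coordinate ring of
pairs `(V, λ)` (`Fradeco.exists_prime_comap_tensorHom_le`), so it suffices to bound the dimension of
the quotient by `q`. By Noether normalization this is at most the transcendence degree of the function
field `K` of the component defined by `p`, and hence, in characteristic zero, the dimension of the
space of derivations of `K`.

The generic point of the component is a unit-norm tight frame `V` over `K`, together with `r`
coefficients, and a derivation is determined by its values on these. So everything comes down to the
dimension of the space of matrices `δ V`. The equations of the funtf variety cut out a space of
the expected dimension only if `V` does not split into mutually orthogonal subframes. However, a
derivation also respects the vanishing of an inner product `v_i · v_j` of columns, and with these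
further linear conditions (`funtfTangent`) the expected dimension is an upper bound for every `V`
(`finrank_funtfTangent_add_le`). This is linear algebra: the dual statement is that there is an
`(r - 1)`-dimensional space of symmetric matrices, supported on the diagonal and on the zeros of the
Gram matrix `G`, in which only `0` commutes with `G` (`exists_symm_family`). Here `G² = (r / n) G`, and
`r > n` enters as `r / n ≠ 1`.
-/

/-! ### Deformations of unit-norm tight frames -/

open Matrix in
/-- A symmetric matrix `G` with unit diagonal and `G² = c G`, `c ≠ 1`, admits a space of symmetric
matrices `D x` of dimension one less than its size that are supported on the diagonal and the zero
entries of `G`, and of which only `0` commutes with `G`.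

For `G` with a connected graph of nonzero entries the diagonal matrices with one fixed zero entry
would do. In general, a diagonal entry is used for each index that is not the chosen representative
of its component, and each representative other than `i₀` contributes the off-diagonal pair of
positions `(i₀, j)`, `(j, i₀)`. -/
theorem exists_symm_family {K κ : Type*} [Field K] [Fintype κ] [DecidableEq κ] [Nonempty κ]
    {G : Matrix κ κ K} {c : K} (hsymm : G.IsSymm) (hGG : G * G = c • G) (hdiag : ∀ j, G j j = 1)
    (hc : c ≠ 1) :
    ∃ (i₀ : κ) (D : ({j // j ≠ i₀} → K) →ₗ[K] Matrix κ κ K), (∀ x, (D x).IsSymm) ∧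
      (∀ x i j, i ≠ j → G i j ≠ 0 → D x i j = 0) ∧ ∀ x, G * D x = D x * G → x = 0 := by
  classical
  let s : Setoid κ := Relation.EqvGen.setoid fun i j => G i j ≠ 0
  let ρ : κ → κ := fun j => (Quotient.mk s j).out
  have hρ : ∀ j, s (ρ j) j := fun j => Quotient.mk_out (s := s) j
  have hρ_eq : ∀ {i j}, s i j → ρ i = ρ j := fun {i j} h => by
    simp only [ρ, Quotient.sound (s := s) h]
  have hρρ : ∀ j, ρ (ρ j) = ρ j := fun j => hρ_eq (hρ j)
  have hG_rel : ∀ {i j}, G i j ≠ 0 → s i j := fun h => Relation.EqvGen.rel _ _ h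
  obtain ⟨i₀, hi₀⟩ : ∃ i₀, ρ i₀ = i₀ := ⟨ρ (Classical.arbitrary κ), hρρ _⟩
  let ext : ({j // j ≠ i₀} → K) → κ → K := fun x j => if h : j ≠ i₀ then x ⟨j, h⟩ else 0
  let E : ({j // j ≠ i₀} → K) → Matrix κ κ K := fun x => of fun i j =>
    if i = j then (if ρ j = j then 0 else ext x j)
    else if i = i₀ ∧ ρ j = j then ext x j else if j = i₀ ∧ ρ i = i then ext x i else 0
  let D : ({j // j ≠ i₀} → K) →ₗ[K] Matrix κ κ K :=
    { toFun := E
      map_add' := by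
        intro x y
        ext i j
        simp only [E, ext, of_apply, Matrix.add_apply, Pi.add_apply]
        split_ifs <;> simp
      map_smul' := by
        intro a x
        ext i j
        simp only [E, ext, of_apply, Matrix.smul_apply, Pi.smul_apply, RingHom.id_apply]
        split_ifs <;> simp }
  have hsupp : ∀ x i j, i ≠ j → E x i j ≠ 0 → ¬ s i j := by
    intro x i j hij hE hs
    apply hij
    have hr : ρ i = i ∧ ρ j = j := by
      simp only [E, of_apply, if_neg hij] at hE
      split_ifs at hE with h1 h2
      · exact ⟨h1.1 ▸ hi₀, h1.2⟩
      · exact ⟨h2.2, h2.1 ▸ hi₀⟩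
      · exact absurd rfl hE
    rw [← hr.1, ← hr.2, hρ_eq hs]
  have hEsymm : ∀ x, (E x).IsSymm := by
    intro x
    ext i j
    simp only [E, of_apply, transpose_apply]
    grind
  refine ⟨i₀, D, hEsymm, ?_, ?_⟩
  · intro x i j hij hG
    by_contra hE
    exact hsupp x i j hij hE (hG_rel hG)
  intro x hcomm
  change G * E x = E x * G at hcomm
  have hmul : ∀ i j, s i j → (G * E x) i j = G i j * E x j j := by
    intro i j hs
    rw [Matrix.mul_apply]
    refine Finset.sum_eq_single j (fun k _ hk => ?_) (by simp)
    by_contra h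
    exact hsupp x k j hk (right_ne_zero_of_mul h)
      (s.trans (s.symm (hG_rel (left_ne_zero_of_mul h))) hs)
  -- Comparing the entries of `G * E x` and `E x * G` where `G` does not vanish, the diagonal of
  -- `E x` is constant on each component; it vanishes at the representatives.
  have hstep : ∀ i j, G i j ≠ 0 → E x i i = E x j j := by
    intro i j hG
    have h1 := hmul i j (hG_rel hG)
    have h2 : (E x * G) i j = G i j * E x i i := by
      rw [← hsymm.apply i j, ← hmul j i (s.symm (hG_rel hG)), ← transpose_apply (G * E x),
        transpose_mul, hsymm.eq, (hEsymm x).eq]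
    rw [hcomm, h2] at h1
    exact mul_left_cancel₀ hG h1
  have hconst : ∀ i j, s i j → E x i i = E x j j := by
    intro i j h
    induction h with
    | rel i j h => exact hstep i j h
    | refl => rfl
    | symm i j _ ih => exact ih.symm
    | trans i j k _ _ ih1 ih2 => exact ih1.trans ih2
  have hzero : ∀ j, E x j j = 0 := by
    intro j
    rw [← hconst _ _ (hρ j)]
    simp [E, hρρ]
  -- The component of `i₀` is not a single index: otherwise the `(i₀, i₀)` entry of `G² = c G` would
  -- give `c = 1`. Row `k` of the commutation relation then kills the off-diagonal coefficients.
  obtain ⟨k, hk, hGk⟩ : ∃ k, k ≠ i₀ ∧ G k i₀ ≠ 0 := by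
    by_contra! h
    apply hc
    have h1 := congrFun (congrFun hGG i₀) i₀
    rw [Matrix.mul_apply, Finset.sum_eq_single i₀ (fun k _ hk => by rw [h k hk, mul_zero])
      (by simp), Matrix.smul_apply, hdiag] at h1
    simpa using h1.symm
  have hk' : ρ k ≠ k := fun h => hk (by rw [← h, hρ_eq (hG_rel hGk), hi₀])
  funext ⟨j, hj⟩
  by_cases hρj : ρ j = j
  · have h1 := congrFun (congrFun hcomm k) j
    rw [Matrix.mul_apply, Finset.sum_eq_single i₀, Matrix.mul_apply, Finset.sum_eq_zero] at h1
    · have h2 : E x i₀ j = x ⟨j, hj⟩ := by simp [E, ext, hρj, hj, hj.symm]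
      rw [h2] at h1
      exact (mul_eq_zero.mp h1).resolve_left hGk
    · intro l _
      rcases eq_or_ne k l with rfl | hl
      · rw [hzero, zero_mul]
      · simp [E, hl, hk, hk']
    · intro l _ hl
      rcases eq_or_ne l j with rfl | hlj
      · rw [hzero, mul_zero]
      · simp [E, hl, hlj, hj]
    · simp
  · have := hzero j
    simpa [E, ext, hρj, hj] using this

open Matrix in
/-- The space of first-order deformations `W` of a frame `V` that preserve `V * Vᵀ`, the diagonal of
the Gram matrix `Vᵀ * V`, and also the zero entries of the Gram matrix. The last condition goes
beyond the equations of the funtf variety. A derivation maps `0` to `0`, so it holds for the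
deformations given by derivations, and it compensates for the drop in rank of the
Jacobian at frames that split into orthogonal subframes. -/
def funtfTangent {K ι κ : Type*} [Field K] [Fintype ι] [Fintype κ] (V : Matrix ι κ K) :
    Submodule K (Matrix ι κ K) where
  carrier := {W | W * Vᵀ + V * Wᵀ = 0 ∧
    ∀ i j, (i = j ∨ (Vᵀ * V) i j = 0) → (Vᵀ * W + Wᵀ * V) i j = 0}
  zero_mem' := by simp
  add_mem' := by
    rintro W W' ⟨h1, h2⟩ ⟨h1', h2'⟩
    refine ⟨?_, fun i j hij => ?_⟩
    · rw [transpose_add, Matrix.add_mul, Matrix.mul_add, add_add_add_comm, h1, h1', add_zero]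
    · rw [transpose_add, Matrix.add_mul, Matrix.mul_add, add_add_add_comm, Matrix.add_apply,
        h2 i j hij, h2' i j hij, add_zero]
  smul_mem' := by
    rintro a W ⟨h1, h2⟩
    refine ⟨?_, fun i j hij => ?_⟩
    · rw [transpose_smul, Matrix.smul_mul, Matrix.mul_smul, ← smul_add, h1, smul_zero]
    · rw [transpose_smul, Matrix.smul_mul, Matrix.mul_smul, ← smul_add, Matrix.smul_apply,
        h2 i j hij, smul_zero]

open Matrix in
/-- The deformations of a unit-norm tight frame `V` span at most the expected dimension
`|ι| |κ| - |ι| (|ι| + 1) / 2 - |κ| + 1`: under the trace pairing they are annihilated by the matrices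
`S V + V D` with `S` symmetric and `D` from `exists_symm_family`, and `(S, D) ↦ S V + V D` is
injective. -/
theorem finrank_funtfTangent_add_le {K ι κ : Type*} [Field K] [CharZero K] [Fintype ι] [DecidableEq ι]
    [Fintype κ] [DecidableEq κ] [Nonempty κ] {V : Matrix ι κ K} {c : K} (hc0 : c ≠ 0) (hc1 : c ≠ 1)
    (hV : V * Vᵀ = c • (1 : Matrix ι ι K)) (hdiag : ∀ j, (Vᵀ * V) j j = 1) :
    Module.finrank K (funtfTangent V) + (Fintype.card ι + 1).choose 2 + Fintype.card κ ≤
      Fintype.card ι * Fintype.card κ + 1 := by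
  classical
  have hGsymm : (Vᵀ * V).IsSymm := by simp [IsSymm, transpose_mul]
  obtain ⟨i₀, D, hDsymm, hDsupp, hD⟩ := exists_symm_family (G := Vᵀ * V) (c := c) hGsymm
    (by rw [Matrix.mul_assoc, ← Matrix.mul_assoc V, hV]; simp) hdiag hc1
  -- Symmetric matrices, parametrized by their entries at unordered pairs of indices.
  let S : (Sym2 ι → K) →ₗ[K] Matrix ι ι K :=
    { toFun := fun f => of fun i j => f s(i, j)
      map_add' := fun _ _ => rfl
      map_smul' := fun _ _ => rfl }
  have hSsymm : ∀ f, (S f).IsSymm := fun f => by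
    ext i j
    exact congrArg f Sym2.eq_swap
  let Ψ : ((Sym2 ι → K) × ({j // j ≠ i₀} → K)) →ₗ[K] Matrix ι κ K :=
    { toFun := fun p => S p.1 * V + V * D p.2
      map_add' := fun p q => by
        simp only [Prod.fst_add, Prod.snd_add, map_add, Matrix.add_mul, Matrix.mul_add]
        abel
      map_smul' := fun a p => by simp }
  have hΨ : Function.Injective Ψ := by
    rw [← LinearMap.ker_eq_bot, LinearMap.ker_eq_bot']
    rintro ⟨f, x⟩ h
    change S f * V + V * D x = 0 at h
    have hSV : S f * V = -(V * D x) := eq_neg_of_add_eq_zero_left h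
    -- `Vᵀ * V * D x = -(Vᵀ * S f * V)` is symmetric, so `D x` commutes with the Gram matrix.
    have hx : x = 0 := by
      apply hD
      have h1 : Vᵀ * V * D x = -(Vᵀ * S f * V) := by
        rw [Matrix.mul_assoc, Matrix.mul_assoc, hSV, Matrix.mul_neg, neg_neg]
      have h2 := congrArg transpose h1
      simp only [transpose_mul, transpose_neg, transpose_transpose, (hSsymm f).eq,
        (hDsymm x).eq] at h2
      rw [h1, h2, Matrix.mul_assoc]
    subst hx
    have hS : S f = 0 := by
      have h1 : S f * V * Vᵀ = 0 := by simp [hSV]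
      rw [Matrix.mul_assoc, hV] at h1
      simpa [hc0] using h1
    have hf : f = 0 := by
      funext z
      induction z using Sym2.ind with
      | _ i j => exact congrFun (congrFun hS i) j
    rw [hf]
    rfl
  -- The trace pairing.
  let β : Matrix ι κ K →ₗ[K] Module.Dual K (Matrix ι κ K) :=
    LinearMap.mk₂ K (fun A B => (Aᵀ * B).trace)
      (fun _ _ _ => by simp [Matrix.add_mul]) (fun _ _ _ => by simp)
      (fun _ _ _ => by simp [Matrix.mul_add]) (fun _ _ _ => by simp)
  have hβ : Function.Injective β := by
    rw [← LinearMap.ker_eq_bot, LinearMap.ker_eq_bot']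
    intro A h
    ext i j
    have h1 := LinearMap.congr_fun h (Matrix.single i j 1)
    have h2 : β A (Matrix.single i j 1) = A i j := by
      simp [β, Matrix.trace_mul_single]
    rw [← h2, h1]
    rfl
  have hann : LinearMap.range (β ∘ₗ Ψ) ≤ (funtfTangent V).dualAnnihilator := by
    rintro _ ⟨⟨f, x⟩, rfl⟩
    rw [Submodule.mem_dualAnnihilator]
    intro W hW
    change ((S f * V + V * D x)ᵀ * W).trace = 0
    rw [transpose_add, Matrix.add_mul, trace_add, transpose_mul, transpose_mul, (hSsymm f).eq,
      (hDsymm x).eq]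
    have h1 : (Vᵀ * S f * W).trace = 0 := by
      have e1 : (Vᵀ * S f * W).trace = (S f * (W * Vᵀ)).trace := by
        rw [Matrix.mul_assoc, trace_mul_comm, Matrix.mul_assoc]
      have e2 : (Vᵀ * S f * W).trace = (S f * (V * Wᵀ)).trace := by
        rw [e1, ← trace_transpose, transpose_mul, transpose_mul, transpose_transpose,
          (hSsymm f).eq, trace_mul_comm]
      have e3 : (Vᵀ * S f * W).trace + (Vᵀ * S f * W).trace = 0 := by
        nth_rw 1 [e1]
        rw [e2, ← trace_add, ← Matrix.mul_add, hW.1]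
        simp
      exact self_eq_neg.mp (eq_neg_of_add_eq_zero_left e3)
    have h2 : (D x * Vᵀ * W).trace = 0 := by
      have e1 : (D x * Vᵀ * W).trace = (D x * (Vᵀ * W)).trace := by rw [Matrix.mul_assoc]
      have e2 : (D x * Vᵀ * W).trace = (D x * (Wᵀ * V)).trace := by
        rw [e1, ← trace_transpose, transpose_mul, transpose_mul, transpose_transpose,
          (hDsymm x).eq, trace_mul_comm]
      have e3 : (D x * Vᵀ * W).trace + (D x * Vᵀ * W).trace = 0 := by
        nth_rw 1 [e1]
        rw [e2, ← trace_add, ← Matrix.mul_add]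
        refine Finset.sum_eq_zero fun i _ => ?_
        rw [diag_apply, Matrix.mul_apply]
        refine Finset.sum_eq_zero fun j _ => ?_
        rcases eq_or_ne j i with rfl | hij
        · rw [hW.2 j j (Or.inl rfl), mul_zero]
        · by_cases hG : (Vᵀ * V) j i = 0
          · rw [hW.2 j i (Or.inr hG), mul_zero]
          · rw [hDsupp x i j hij.symm (by rwa [hGsymm.apply]), zero_mul]
      exact self_eq_neg.mp (eq_neg_of_add_eq_zero_left e3)
    rw [h1, h2, add_zero]
  have hrank : Module.finrank K (LinearMap.range (β ∘ₗ Ψ)) =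
      (Fintype.card ι + 1).choose 2 + (Fintype.card κ - 1) := by
    rw [LinearMap.finrank_range_of_inj (by simpa using hβ.comp hΨ), Module.finrank_prod,
      Module.finrank_fintype_fun_eq_card, Module.finrank_fintype_fun_eq_card, Sym2.card,
      Fintype.card_subtype_compl]
    simp
  have hle := Submodule.finrank_mono hann
  have hdual := Subspace.finrank_add_finrank_dualAnnihilator_eq (funtfTangent V)
  have hcard : 0 < Fintype.card κ := Fintype.card_pos
  rw [Module.finrank_matrix, Module.finrank_self, mul_one] at hdual
  lia

/-! ### Derivations and transcendence degree -/

/-- Derivations extend along formally étale extensions, because `Ω[K⁄k]` is the base change of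
`Ω[R⁄k]`. -/
theorem exists_derivation_extend_of_formallyEtale {k R K : Type*} [CommRing k] [CommRing R]
    [CommRing K] [Algebra k R] [Algebra k K] [Algebra R K] [IsScalarTower k R K]
    [Algebra.FormallyEtale R K] (d : Derivation k R K) :
    ∃ D : Derivation k K K, ∀ x : R, D (algebraMap R K x) = d x := by
  refine ⟨(d.liftKaehlerDifferential.liftBaseChange K ∘ₗ
    (KaehlerDifferential.tensorKaehlerEquivOfFormallyEtale k R K).symm.toLinearMap).compDer
      (KaehlerDifferential.D k K), fun x => ?_⟩
  change d.liftKaehlerDifferential.liftBaseChange K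
    ((KaehlerDifferential.tensorKaehlerEquivOfFormallyEtale k R K).symm
      (KaehlerDifferential.D k K (algebraMap R K x))) = _
  rw [KaehlerDifferential.tensorKaehlerEquivOfFormallyEtale_symm_D_algebraMap]
  simp

/-- A field of characteristic zero that is algebraic over a domain is formally étale over it: the
fraction field is a localization, and the remaining extension is separable. -/
theorem formallyEtale_of_isAlgebraic (R K : Type*) [CommRing R] [IsDomain R] [Field K] [CharZero K]
    [Algebra R K] [FaithfulSMul R K] [Algebra.IsAlgebraic R K] : Algebra.FormallyEtale R K := by
  let := FractionRing.liftAlgebra R K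
  have : Algebra.IsAlgebraic (FractionRing R) K :=
    Algebra.IsAlgebraic.extendScalars (IsFractionRing.injective R (FractionRing R))
  have : CharZero (FractionRing R) :=
    (algebraMap (FractionRing R) K).charZero_iff (algebraMap (FractionRing R) K).injective |>.2
      inferInstance
  have : Algebra.FormallyEtale (FractionRing R) K := .of_isSeparable _ _
  have : Algebra.FormallyEtale R (FractionRing R) := .of_isLocalization (nonZeroDivisors R)
  exact .comp R (FractionRing R) K

theorem exists_derivation_of_formallyEtale_mvPolynomial {k K t : Type*} [Field k] [Field K]
    [Algebra k K] [Algebra (MvPolynomial t k) K] [IsScalarTower k (MvPolynomial t k) K]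
    [Algebra.FormallyEtale (MvPolynomial t k) K] (v : t → K) :
    ∃ D : Derivation k K K, ∀ i, D (algebraMap (MvPolynomial t k) K (.X i)) = v i := by
  obtain ⟨D, hD⟩ := exists_derivation_extend_of_formallyEtale (K := K)
    (MvPolynomial.mkDerivation k v)
  exact ⟨D, fun i => (hD _).trans (MvPolynomial.mkDerivation_X _ _ _)⟩

/-- A derivation of a field of characteristic zero may be prescribed on a transcendence basis. -/
theorem IsTranscendenceBasis.exists_derivation {k K t : Type*} [Field k] [CharZero k] [Field K]
    [Algebra k K] {x : t → K} (hx : IsTranscendenceBasis k x) (v : t → K) :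
    ∃ D : Derivation k K K, ∀ i, D (x i) = v i := by
  let f : MvPolynomial t k →ₐ[k] K := MvPolynomial.aeval x
  let : Algebra (MvPolynomial t k) K := f.toRingHom.toAlgebra
  have hf : ∀ i, algebraMap (MvPolynomial t k) K (.X i) = x i := fun i => MvPolynomial.aeval_X x i
  have : IsScalarTower k (MvPolynomial t k) K := .of_algebraMap_eq fun x => (f.commutes x).symm
  have : FaithfulSMul (MvPolynomial t k) K := (faithfulSMul_iff_algebraMap_injective _ K).2 hx.1
  have : CharZero K := charZero_of_injective_algebraMap (algebraMap k K).injective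
  have : Algebra.IsAlgebraic (MvPolynomial t k) K := by
    refine (Algebra.isAlgebraic_ringHom_iff_of_comp_eq hx.1.aevalEquiv (RingEquiv.refl K) ?_).1
      hx.isAlgebraic
    exact RingHom.ext hx.1.algebraMap_aevalEquiv
  have := formallyEtale_of_isAlgebraic (MvPolynomial t k) K
  obtain ⟨D, hD⟩ := exists_derivation_of_formallyEtale_mvPolynomial (k := k) v
  exact ⟨D, fun i => by rw [← hf, hD]⟩

theorem exists_dual_derivations {k K ι : Type*} [Field k] [CharZero k] [Field K]
    [Algebra k K] [DecidableEq ι] {y : ι → K} (hy : AlgebraicIndependent k y) :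
    ∃ δ : ι → Derivation k K K, ∀ i j, δ i (y j) = if i = j then 1 else 0 := by
  classical
  obtain ⟨t, hyt, ht⟩ := exists_isTranscendenceBasis_superset hy.coe_range
  have hD (i : ι) := ht.exists_derivation (Pi.single (⟨y i, hyt ⟨i, rfl⟩⟩ : t) (1 : K))
  choose D hD using hD
  refine ⟨D, fun i j => (hD i ⟨y j, hyt ⟨j, rfl⟩⟩).trans ?_⟩
  simp [Pi.single_apply, hy.injective.eq_iff, eq_comm]

/-- The dimension of a finitely generated algebra over a field is bounded by the length of some
algebraically independent family, by Noether normalization and incomparability of primes in an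
integral extension. -/
theorem exists_algebraicIndependent_ringKrullDim_le (k B : Type*) [Field k] [CommRing B]
    [Nontrivial B] [Algebra k B] [Algebra.FiniteType k B] :
    ∃ (s : ℕ) (y : Fin s → B), AlgebraicIndependent k y ∧ ringKrullDim B ≤ s := by
  obtain ⟨s, g, hg, hint⟩ := exists_integral_inj_algHom_of_fg k B
  refine ⟨s, fun i => g (.X i), ?_, ?_⟩
  · have := (MvPolynomial.algebraicIndependent_X (Fin s) k).map' hg
    exact this
  · algebraize [g.toRingHom]
    have : ringKrullDim B ≤ ringKrullDim (MvPolynomial (Fin s) k) := by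
      refine Order.krullDim_le_of_strictMono (PrimeSpectrum.comap (algebraMap _ B)) ?_
      intro p q hpq
      exact Ideal.IsIntegral.comap_lt_comap (R := MvPolynomial (Fin s) k) hpq
    simpa using this

open Matrix in
theorem Derivation.map_matrix_mul_apply {k K ι κ μ : Type*} [CommRing k] [CommRing K] [Algebra k K]
    [Fintype κ] (δ : Derivation k K K) (A : Matrix ι κ K) (B : Matrix κ μ K) (i : ι) (j : μ) :
    δ ((A * B) i j) = (A.map δ * B + A * B.map δ) i j := by
  simp only [Matrix.mul_apply, Matrix.add_apply, map_sum, Derivation.leibniz, smul_eq_mul,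
    Matrix.map_apply, Finset.sum_add_distrib]
  rw [add_comm]
  congr 1
  exact Finset.sum_congr rfl fun _ _ => mul_comm _ _

open Matrix in
/-- If the entries of a unit-norm tight frame `V` and of `lam` generate `K` over `k`, in the sense that
no nonzero derivation kills them all, then the transcendence degree of `K` is at most the expected
dimension of the funtf variety plus `|κ|`: a derivation is determined by its values on `V`, which
form an element of `funtfTangent V`, and on `lam`. -/
theorem card_add_choose_le_of_algebraicIndependent {k K ι κ σ : Type*} [Field k] [CharZero k]
    [Field K] [Algebra k K] [Fintype ι] [DecidableEq ι] [Fintype κ] [DecidableEq κ] [Nonempty κ]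
    [Fintype σ] {V : Matrix ι κ K} {lam : κ → K} {c : k} (hc0 : c ≠ 0) (hc1 : c ≠ 1)
    (hV : V * Vᵀ = algebraMap k K c • (1 : Matrix ι ι K)) (hdiag : ∀ j, (Vᵀ * V) j j = 1)
    (hgen : ∀ δ : Derivation k K K, (∀ i j, δ (V i j) = 0) → (∀ j, δ (lam j) = 0) → δ = 0)
    {y : σ → K} (hy : AlgebraicIndependent k y) :
    Fintype.card σ + (Fintype.card ι + 1).choose 2 ≤ Fintype.card ι * Fintype.card κ + 1 := by
  classical
  have : CharZero K := charZero_of_injective_algebraMap (algebraMap k K).injective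
  have hT := finrank_funtfTangent_add_le ((map_ne_zero (algebraMap k K)).2 hc0)
    (fun h => hc1 ((algebraMap k K).injective (by rw [h, map_one]))) hV hdiag
  have hmem : ∀ δ : Derivation k K K, V.map δ ∈ funtfTangent V := by
    intro δ
    refine ⟨?_, fun i j hij => ?_⟩
    · ext i j
      rw [← transpose_map, ← δ.map_matrix_mul_apply, hV, Matrix.smul_apply, one_apply]
      split_ifs <;> simp
    · rw [add_comm, ← transpose_map, ← δ.map_matrix_mul_apply]
      rcases hij with rfl | hij
      · rw [hdiag, Derivation.map_one_eq_zero]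
      · rw [hij, map_zero]
  let ev : Derivation k K K →ₗ[K] funtfTangent V × (κ → K) :=
    { toFun := fun δ => (⟨V.map δ, hmem δ⟩, fun j => δ (lam j))
      map_add' := fun _ _ => rfl
      map_smul' := fun _ _ => rfl }
  have hev : LinearMap.ker ev = ⊥ := by
    refine LinearMap.ker_eq_bot'.2 fun δ hδ => hgen δ (fun i j => ?_) fun j => ?_
    · exact congrFun (congrFun (congrArg (fun p => (p.1 : Matrix ι κ K)) hδ) i) j
    · exact congrFun (congrArg Prod.snd hδ) j
  obtain ⟨δ, hδ⟩ := exists_dual_derivations hy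
  have hli : LinearIndependent K δ := by
    rw [Fintype.linearIndependent_iff]
    intro a ha j
    have h := congrFun (congrArg Derivation.coeFnAddMonoidHom ha) (y j)
    rw [map_sum] at h
    simpa [hδ] using h
  have hcard := (hli.map' ev hev).fintype_card_le_finrank
  rw [Module.finrank_prod, Module.finrank_fintype_fun_eq_card] at hcard
  lia

theorem Derivation.eq_zero_of_mvPolynomial_generators {k A K σ : Type*} [CommRing k] [CommRing A]
    [IsDomain A] [Field K] [Algebra k A] [Algebra k K] [Algebra A K] [IsScalarTower k A K]
    [IsFractionRing A K] {π : MvPolynomial σ k →ₐ[k] A} (hπ : Function.Surjective π)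
    {δ : Derivation k K K} (hδ : ∀ i, δ (algebraMap A K (π (.X i))) = 0) : δ = 0 := by
  have hA : ∀ a : A, δ (algebraMap A K a) = 0 := by
    intro a
    obtain ⟨f, rfl⟩ := hπ a
    induction f using MvPolynomial.induction_on with
    | C x =>
      rw [← MvPolynomial.algebraMap_eq, AlgHom.commutes, ← IsScalarTower.algebraMap_apply,
        Derivation.map_algebraMap]
    | add f g hf hg => simp [hf, hg]
    | mul_X f i hf => simp [hf, hδ]
  ext x
  obtain ⟨a, b, -, rfl⟩ := IsFractionRing.div_surjective (A := A) x
  simp [Derivation.leibniz_div, hA]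

theorem ringKrullDim_quotient_ker_le {k R K : Type*} [Field k] [CommRing R] [Field K] [Algebra k R]
    [Algebra.FiniteType k R] [Algebra k K] (ψ : R →ₐ[k] K) {M : ℕ}
    (hM : ∀ (s : ℕ) (y : Fin s → K), AlgebraicIndependent k y → s ≤ M) :
    ringKrullDim (R ⧸ RingHom.ker ψ) ≤ M := by
  have := (RingHom.ker_isPrime (ψ : R →+* K)).ne_top
  have : Nontrivial (R ⧸ RingHom.ker ψ) := Ideal.Quotient.nontrivial_iff.2 this
  obtain ⟨s, y, hy, hdim⟩ := exists_algebraicIndependent_ringKrullDim_le k (R ⧸ RingHom.ker ψ)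
  refine hdim.trans ?_
  exact_mod_cast hM s _ (hy.map' (f := Ideal.kerLiftAlg ψ) (Ideal.kerLiftAlg_injective ψ))

namespace Fradeco

/-! ### Ideals of affine cones -/

section

variable {ι : Type}

open Polynomial in
/-- The restriction of `f` to the line through `0` and `w`, as the polynomial `f (t w)` in `t`. -/
noncomputable def linePoly (w : ι → ℂ) : MvPolynomial ι ℂ →ₐ[ℂ] ℂ[X] :=
  MvPolynomial.aeval fun i => C (w i) * X

theorem eval_linePoly (w : ι → ℂ) (f : MvPolynomial ι ℂ) (t : ℂ) :
    (linePoly w f).eval t = MvPolynomial.eval (t • w) f := by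
  have : (Polynomial.evalRingHom t).comp (linePoly w).toRingHom = MvPolynomial.eval (t • w) := by
    ext i
    · simp [linePoly]
    · simp only [linePoly, RingHom.comp_apply, AlgHom.toRingHom_eq_coe, RingHom.coe_coe,
        MvPolynomial.aeval_X, Polynomial.coe_evalRingHom, Polynomial.eval_mul, Polynomial.eval_C,
        Polynomial.eval_X, MvPolynomial.eval_X, Pi.smul_apply, smul_eq_mul]
      ring
  exact congrArg (fun g => g f) this

theorem linePoly_eq_zero_iff (w : ι → ℂ) (f : MvPolynomial ι ℂ) :
    linePoly w f = 0 ↔ ∀ t : ℂ, t ≠ 0 → MvPolynomial.eval (t • w) f = 0 := by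
  constructor
  · intro h t _
    rw [← eval_linePoly, h, Polynomial.eval_zero]
  · intro h
    refine Polynomial.eq_zero_of_infinite_isRoot _
      ((Set.finite_singleton (0 : ℂ)).infinite_compl.mono fun t ht => ?_)
    rw [Set.mem_ofPred_eq, Polynomial.IsRoot.def, eval_linePoly]
    exact h t ht

theorem linePoly_of_isHomogeneous (w : ι → ℂ) {f : MvPolynomial ι ℂ} {m : ℕ}
    (hf : f.IsHomogeneous m) :
    linePoly w f = Polynomial.monomial m (MvPolynomial.eval w f) := by
  refine Polynomial.funext fun t => ?_
  rw [eval_linePoly, Polynomial.eval_monomial, MvPolynomial.eval_eq, MvPolynomial.eval_eq,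
    Finset.sum_mul]
  refine Finset.sum_congr rfl fun e he => ?_
  have hm : e.degree = m := by
    by_contra hne
    exact MvPolynomial.mem_support_iff.mp he (hf.coeff_eq_zero hne)
  simp_rw [Pi.smul_apply, smul_eq_mul, mul_pow, Finset.prod_mul_distrib,
    Finset.prod_pow_eq_pow_sum, ← hm, Finsupp.degree_apply]
  ring

theorem coeff_linePoly (w : ι → ℂ) (f : MvPolynomial ι ℂ) (m : ℕ) :
    (linePoly w f).coeff m = MvPolynomial.eval w (MvPolynomial.homogeneousComponent m f) := by
  conv_lhs => rw [← MvPolynomial.sum_homogeneousComponent f, map_sum, Polynomial.finsetSum_coeff]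
  simp_rw [linePoly_of_isHomogeneous w (MvPolynomial.homogeneousComponent_isHomogeneous _ f),
    Polynomial.coeff_monomial]
  rw [Finset.sum_ite_eq']
  split_ifs with h
  · rfl
  · rw [MvPolynomial.homogeneousComponent_eq_zero _ _ (by simpa using h), map_zero]

/-- The points of projective space at all of whose representatives `f` vanishes, that is, such that
`f` vanishes on the line through the origin that they represent. Here `f` need not be
homogeneous. -/
def coneZero (f : MvPolynomial ι ℂ) : Set (ℙ ℂ (ι → ℂ)) :=
  {p | linePoly p.rep f = 0}

theorem mk_mem_coneZero_iff {f : MvPolynomial ι ℂ} {w : ι → ℂ} (hw : w ≠ 0) :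
    Projectivization.mk ℂ w hw ∈ coneZero f ↔
      ∀ t : ℂ, t ≠ 0 → MvPolynomial.eval (t • w) f = 0 := by
  obtain ⟨a, ha⟩ := Projectivization.exists_smul_eq_mk_rep ℂ w hw
  rw [coneZero, Set.mem_ofPred_eq, ← ha, linePoly_eq_zero_iff]
  constructor
  · intro h t ht
    have := h (t * (↑a⁻¹ : ℂ)) (mul_ne_zero ht a⁻¹.ne_zero)
    rwa [Units.smul_def, smul_smul, mul_assoc, Units.inv_mul, mul_one] at this
  · intro h t ht
    rw [Units.smul_def, smul_smul]
    exact h _ (mul_ne_zero ht a.ne_zero)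

/-- `f` vanishes on a line through the origin iff all its homogeneous components do. -/
theorem isProjAlgebraic_coneZero (f : MvPolynomial ι ℂ) : IsProjAlgebraic ι (coneZero f) := by
  refine ⟨Set.range fun m => MvPolynomial.homogeneousComponent m f, ?_, ?_⟩
  · rintro _ ⟨m, rfl⟩
    exact ⟨m, MvPolynomial.homogeneousComponent_isHomogeneous _ _⟩
  · ext p
    simp [coneZero, projZeroLocus, Polynomial.ext_iff, coeff_linePoly]

theorem coneZero_mul (f g : MvPolynomial ι ℂ) : coneZero (f * g) = coneZero f ∪ coneZero g := by
  ext p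
  simp [coneZero]

/-- The ideal of all polynomials vanishing on the affine cone over `Z`. -/
noncomputable def coneIdeal (Z : Set (ℙ ℂ (ι → ℂ))) : Ideal (MvPolynomial ι ℂ) :=
  ⨅ p ∈ Z, RingHom.ker (linePoly p.rep)

theorem mem_coneIdeal_iff {Z : Set (ℙ ℂ (ι → ℂ))} {f : MvPolynomial ι ℂ} :
    f ∈ coneIdeal Z ↔ Z ⊆ coneZero f := by
  simp [coneIdeal, coneZero, Set.subset_def, RingHom.mem_ker]

theorem coneIdeal_anti {Z Z' : Set (ℙ ℂ (ι → ℂ))} (h : Z ⊆ Z') : coneIdeal Z' ≤ coneIdeal Z :=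
  fun _ hf => mem_coneIdeal_iff.2 (h.trans (mem_coneIdeal_iff.1 hf))

theorem coneIdeal_zariskiClosure (Z : Set (ℙ ℂ (ι → ℂ))) :
    coneIdeal (zariskiClosure ι Z) = coneIdeal Z := by
  let := zariski ι
  refine le_antisymm (coneIdeal_anti subset_closure) fun f hf => mem_coneIdeal_iff.2 ?_
  exact closure_minimal (mem_coneIdeal_iff.1 hf)
    (isClosed_zariski_iff.2 (isProjAlgebraic_coneZero f))

theorem subset_of_coneIdeal_le {Z Z' : Set (ℙ ℂ (ι → ℂ))} (hZ : IsProjAlgebraic ι Z)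
    (h : coneIdeal Z ≤ coneIdeal Z') : Z' ⊆ Z := by
  obtain ⟨S, hS, rfl⟩ := hZ
  intro p hp f hf
  obtain ⟨m, hm⟩ := hS f hf
  have key : ∀ q : ℙ ℂ (ι → ℂ), q ∈ coneZero f ↔ MvPolynomial.eval q.rep f = 0 := fun q => by
    simp [coneZero, linePoly_of_isHomogeneous _ hm]
  exact (key p).1 (mem_coneIdeal_iff.1 (h (mem_coneIdeal_iff.2 fun q hq => (key q).2 (hq f hf))) hp)

theorem isPrime_coneIdeal {Z : Set (ℙ ℂ (ι → ℂ))} (hZ : @IsIrreducible _ (zariski ι) Z) :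
    (coneIdeal Z).IsPrime := by
  let := zariski ι
  constructor
  · rw [Ideal.ne_top_iff_one, mem_coneIdeal_iff]
    intro h
    obtain ⟨p, hp⟩ := hZ.nonempty
    simpa [coneZero] using h hp
  · intro f g hfg
    simp only [mem_coneIdeal_iff, coneZero_mul] at hfg ⊢
    exact isPreirreducible_iff_isClosed_union_isClosed.1 hZ.isPreirreducible _ _
      (isClosed_zariski_iff.2 (isProjAlgebraic_coneZero f))
      (isClosed_zariski_iff.2 (isProjAlgebraic_coneZero g)) hfg

theorem coneIdeal_lt_ker_eval_zero {Z : Set (ℙ ℂ (ι → ℂ))} (hZ : Z.Nonempty) :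
    coneIdeal Z < RingHom.ker (MvPolynomial.eval (0 : ι → ℂ)) := by
  obtain ⟨p, hp⟩ := hZ
  rw [SetLike.lt_iff_le_and_exists]
  constructor
  · intro f hf
    have h : linePoly p.rep f = 0 := mem_coneIdeal_iff.1 hf hp
    rw [RingHom.mem_ker, ← zero_smul ℂ p.rep, ← eval_linePoly, h, Polynomial.eval_zero]
  · obtain ⟨i, hi⟩ := Function.ne_iff.1 p.rep_nonzero
    refine ⟨.X i, by simp [RingHom.mem_ker], fun h => ?_⟩
    have h : linePoly p.rep (.X i) = 0 := mem_coneIdeal_iff.1 h hp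
    simp [linePoly] at h
    exact hi h

/-- If every prime ideal containing the ideal of the cone over `Z` contains some `q` whose quotient
has dimension at most `M`, then `Z` has dimension at most `M - 1`: a chain of irreducible closed
subsets of `Z` gives a chain of prime ideals, which is one step longer as the ideal of the origin
can be added on top. -/
theorem zariskiDim_le_of_ringKrullDim_quotient_le {Z : Set (ℙ ℂ (ι → ℂ))} {M : ℕ}
    (hM : ∀ P : Ideal (MvPolynomial ι ℂ), P.IsPrime → coneIdeal Z ≤ P →
      ∃ q ≤ P, ringKrullDim (MvPolynomial ι ℂ ⧸ q) ≤ M) (hZ : IsProjAlgebraic ι Z) :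
    zariskiDim ι Z ≤ (M - 1 : ℕ) := by
  let := zariski ι
  refine iSup_le fun p => ?_
  suffices h : p.length + 1 ≤ M by exact_mod_cast (by lia : p.length ≤ M - 1)
  have hcl : IsClosed Z := isClosed_zariski_iff.2 hZ
  let φ : TopologicalSpace.IrreducibleCloseds Z → PrimeSpectrum (MvPolynomial ι ℂ) := fun Y =>
    ⟨coneIdeal (Subtype.val '' (Y : Set Z)),
      isPrime_coneIdeal (Y.isIrreducible.image _ continuous_subtype_val.continuousOn)⟩
  have hφ : StrictAnti φ := by
    intro Y Y' h
    change coneIdeal _ < coneIdeal _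
    refine lt_of_le_not_ge (coneIdeal_anti (Set.image_mono h.le)) fun hle => h.not_ge ?_
    have := subset_of_coneIdeal_le (isClosed_zariski_iff.1
      (hcl.isClosedEmbedding_subtypeVal.isClosedMap _ Y.isClosed)) hle
    exact (Set.image_subset_image_iff Subtype.val_injective).1 this
  let m : PrimeSpectrum (MvPolynomial ι ℂ) :=
    ⟨RingHom.ker (MvPolynomial.eval (0 : ι → ℂ)), RingHom.ker_isPrime _⟩
  -- The ideals of the members of the chain, in reversed order.
  let c₀ : LTSeries (PrimeSpectrum (MvPolynomial ι ℂ)) :=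
    LTSeries.mk p.length (fun i => φ (p i.rev)) fun i j hij =>
      hφ (p.strictMono (Fin.rev_lt_rev.2 hij))
  let c : LTSeries (PrimeSpectrum (MvPolynomial ι ℂ)) := c₀.snoc m
    (coneIdeal_lt_ker_eval_zero ((p (Fin.last p.length).rev).isIrreducible.nonempty.image _))
  have hc : c.head = φ (p (Fin.rev 0)) := RelSeries.head_snoc _ _ _
  obtain ⟨q, hq, hdim⟩ := hM c.head.asIdeal c.head.isPrime (by
    rw [hc]
    exact coneIdeal_anti (Subtype.coe_image_subset _ _))
  let c' : LTSeries (PrimeSpectrum.zeroLocus (R := MvPolynomial ι ℂ) q) :=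
    LTSeries.mk c.length (fun i => ⟨c i, hq.trans (c.head_le i)⟩) fun i j hij => c.strictMono hij
  have h := (Order.LTSeries.length_le_krullDim c').trans (ringKrullDim_quotient q ▸ hdim)
  have hlen : c'.length = p.length + 1 := rfl
  rw [hlen] at h
  exact_mod_cast h

end

/-! ### The parametrization of the fradeco variety -/

section

open MvPolynomial

/-- The coordinate ring of the space of pairs `(V, λ)` of an `n × r` matrix and a vector of
coefficients: `Sum.inl (i, j)` is the variable for `V i j` and `Sum.inr j` the one for `λ j`. -/
abbrev ParamRing (r n : ℕ) : Type := MvPolynomial ((Fin n × Fin r) ⊕ Fin r) ℂ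

/-- The `n × r` matrix of variables. -/
noncomputable def genericFrame (r n : ℕ) : Matrix (Fin n) (Fin r) (ParamRing r n) :=
  Matrix.of fun i j => X (Sum.inl (i, j))

/-- The ideal generated by the defining equations of the funtf variety. Whether it
is radical plays no role. -/
noncomputable def funtfIdeal (r n : ℕ) : Ideal (ParamRing r n) :=
  Ideal.span
    (Set.range (fun p : Fin n × Fin n => (genericFrame r n * (genericFrame r n).transpose) p.1 p.2 -
        if p.1 = p.2 then C ((r : ℂ) / n) else 0) ∪
      Set.range fun j => ((genericFrame r n).transpose * genericFrame r n) j j - 1)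

/-- The pullback of polynomials along the parametrization `(V, λ) ↦ ∑ j, λ_j v_j^{⊗ d}`. -/
noncomputable def tensorHom (r n d : ℕ) : MvPolynomial (Sym (Fin n) d) ℂ →ₐ[ℂ] ParamRing r n :=
  aeval fun s => ∑ j, X (Sum.inr j) *
    ((s : Multiset (Fin n)).map fun i => genericFrame r n i j).prod

/-- The pair `(V, lam)` as a point of affine space. -/
def paramPoint {r n : ℕ} (V : Matrix (Fin n) (Fin r) ℂ) (lam : Fin r → ℂ) :
    (Fin n × Fin r) ⊕ Fin r → ℂ :=
  Sum.elim (fun p => V p.1 p.2) lam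

theorem eval_tensorHom {r n d : ℕ} (V : Matrix (Fin n) (Fin r) ℂ) (lam : Fin r → ℂ)
    (f : MvPolynomial (Sym (Fin n) d) ℂ) :
    eval (paramPoint V lam) (tensorHom r n d f) = eval (decomposedTensor d V lam) f := by
  have : (eval (paramPoint V lam)).comp (tensorHom r n d).toRingHom =
      eval (decomposedTensor d V lam) := by
    ext s
    · simp
    · simp [tensorHom, decomposedTensor, paramPoint, genericFrame, map_multiset_prod,
        Function.comp_def]
  exact congrArg (fun g => g f) this

theorem funtfIdeal_le_ker_eval {r n : ℕ} {V : Matrix (Fin n) (Fin r) ℂ} (hV : V ∈ funtfVariety r n)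
    (lam : Fin r → ℂ) : funtfIdeal r n ≤ RingHom.ker (eval (paramPoint V lam)) := by
  rw [funtfIdeal, Ideal.span_le]
  rintro _ (⟨⟨i, j⟩, rfl⟩ | ⟨j, rfl⟩)
  · have := congrFun (congrFun hV.1 i) j
    simp only [SetLike.mem_coe, RingHom.mem_ker, map_sub, sub_eq_zero]
    simpa [Matrix.mul_apply, genericFrame, paramPoint, Matrix.one_apply, apply_ite] using this
  · have := hV.2 j
    simp only [SetLike.mem_coe, RingHom.mem_ker, map_sub, sub_eq_zero]
    simpa [Matrix.mul_apply, genericFrame, paramPoint, sq] using this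

theorem mem_coneIdeal_of_tensorHom_mem_radical {r n d : ℕ} {f : MvPolynomial (Sym (Fin n) d) ℂ}
    (hf : tensorHom r n d f ∈ (funtfIdeal r n).radical) : f ∈ coneIdeal (fradecoVariety r n d) := by
  rw [fradecoVariety, coneIdeal_zariskiClosure, mem_coneIdeal_iff]
  rintro _ ⟨V, hV, lam, h, rfl⟩
  rw [mk_mem_coneZero_iff]
  intro t _
  have ht : t • decomposedTensor d V lam = decomposedTensor d V (t • lam) := by
    ext s
    simp [decomposedTensor, Finset.mul_sum, mul_assoc]
  rw [ht, ← eval_tensorHom, ← RingHom.mem_ker]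
  exact (RingHom.ker_isPrime _).radical_le_iff.2 (funtfIdeal_le_ker_eval hV _) hf

/-- A prime containing the ideal of the cone over the fradeco variety contains the pullback of one of
the finitely many minimal primes of `funtfIdeal`, since it contains the intersection of these
pullbacks. -/
theorem exists_prime_comap_tensorHom_le {r n d : ℕ} {P : Ideal (MvPolynomial (Sym (Fin n) d) ℂ)}
    (hP : P.IsPrime) (h : coneIdeal (fradecoVariety r n d) ≤ P) :
    ∃ p : Ideal (ParamRing r n), p.IsPrime ∧ funtfIdeal r n ≤ p ∧ p.comap (tensorHom r n d) ≤ P := by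
  have hfin := (funtfIdeal r n).finite_minimalPrimes_of_isNoetherianRing
  have hinf : hfin.toFinset.inf (fun p => p.comap (tensorHom r n d)) ≤ P := by
    refine le_trans (fun f hf => mem_coneIdeal_of_tensorHom_mem_radical ?_) h
    rw [← Ideal.sInf_minimalPrimes, Ideal.mem_sInf]
    intro p hp
    exact (Finset.inf_le (hfin.mem_toFinset.2 hp) :
      hfin.toFinset.inf (fun p => p.comap (tensorHom r n d)) ≤ _) hf
  obtain ⟨p, hp, hle⟩ := (Ideal.IsPrime.inf_le' hP).1 hinf
  have hp := hfin.mem_toFinset.1 hp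
  exact ⟨p, hp.1.1, hp.1.2, hle⟩

/-- The closure of the image of an irreducible component of the parameter space has at most the
expected dimension; the component enters through its generic point, which is a unit-norm tight frame
over its function field. -/
theorem ringKrullDim_quotient_comap_tensorHom_le {r n d : ℕ} (hn : 1 ≤ n) (hr : n < r)
    {p : Ideal (ParamRing r n)} (hp : p.IsPrime) (hJ : funtfIdeal r n ≤ p) :
    ringKrullDim (MvPolynomial (Sym (Fin n) d) ℂ ⧸ p.comap (tensorHom r n d)) ≤
      (n * r + 1 - (n + 1).choose 2 : ℕ) := by
  let K := FractionRing (ParamRing r n ⧸ p)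
  let π : ParamRing r n →ₐ[ℂ] ParamRing r n ⧸ p := Ideal.Quotient.mkₐ ℂ p
  let θ : ParamRing r n →ₐ[ℂ] K := (IsScalarTower.toAlgHom ℂ (ParamRing r n ⧸ p) K).comp π
  have hθ : ∀ x, θ x = 0 ↔ x ∈ p := fun x => by
    change algebraMap (ParamRing r n ⧸ p) K (Ideal.Quotient.mk p x) = 0 ↔ _
    rw [FaithfulSMul.algebraMap_eq_zero_iff, Ideal.Quotient.eq_zero_iff_mem]
  have hker : p.comap (tensorHom r n d) = RingHom.ker (θ.comp (tensorHom r n d)) := by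
    ext f
    simp [RingHom.mem_ker, hθ]
  rw [hker]
  refine ringKrullDim_quotient_ker_le _ fun s y hy => ?_
  have : Nonempty (Fin r) := ⟨⟨0, by lia⟩⟩
  have hn0 : (n : ℂ) ≠ 0 := by exact_mod_cast (by lia : n ≠ 0)
  have hr0 : (r : ℂ) ≠ 0 := by exact_mod_cast (by lia : r ≠ 0)
  have hbound := card_add_choose_le_of_algebraicIndependent (V := (genericFrame r n).map θ)
    (lam := fun j => θ (X (Sum.inr j))) (c := (r : ℂ) / n) (div_ne_zero hr0 hn0)
    (fun h => hr.ne' (by exact_mod_cast (div_eq_one_iff_eq hn0).1 h)) ?_ ?_ ?_ hy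
  · simp only [Fintype.card_fin] at hbound
    lia
  · ext i j
    have h := (hθ _).2 (hJ (Ideal.subset_span (Or.inl ⟨(i, j), rfl⟩)))
    rw [map_sub, sub_eq_zero, apply_ite θ, map_zero, ← MvPolynomial.algebraMap_eq,
      AlgHom.commutes] at h
    rw [← Matrix.transpose_map, ← Matrix.map_mul, Matrix.map_apply, h, Matrix.smul_apply,
      Matrix.one_apply, smul_ite, smul_zero, smul_eq_mul, mul_one]
  · intro j
    have h := (hθ _).2 (hJ (Ideal.subset_span (Or.inr ⟨j, rfl⟩)))
    rw [map_sub, sub_eq_zero, map_one] at h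
    rw [← Matrix.transpose_map, ← Matrix.map_mul, Matrix.map_apply, h]
  · intro δ hδ hδ'
    refine Derivation.eq_zero_of_mvPolynomial_generators (A := ParamRing r n ⧸ p) (π := π)
      (Ideal.Quotient.mkₐ_surjective _ _) ?_
    rintro (⟨i, j⟩ | j)
    · exact hδ i j
    · exact hδ' j

theorem zariskiDim_le_projective {ι : Type} [Finite ι] {Z : Set (ℙ ℂ (ι → ℂ))}
    (hZ : IsProjAlgebraic ι Z) : zariskiDim ι Z ≤ (Nat.card ι - 1 : ℕ) := by
  refine zariskiDim_le_of_ringKrullDim_quotient_le (fun P _ _ => ⟨⊥, bot_le, ?_⟩) hZ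
  exact (ringKrullDim_quotient_le _).trans (by simp)

theorem isProjAlgebraic_fradecoVariety (r n d : ℕ) :
    IsProjAlgebraic (Sym (Fin n) d) (fradecoVariety r n d) := by
  let := zariski (Sym (Fin n) d)
  exact isClosed_zariski_iff.1 isClosed_closure

end

end Fradeco

/-! ### The dimension bound -/

theorem mul_add_one_sub_choose_sub_one_le {r n : ℕ} (hn : 1 ≤ n) (hr : n < r) :
    n * r + 1 - (n + 1).choose 2 - 1 ≤ (n - 1) * (r - n) + (n - 1) * (n - 2) / 2 + r - 1 := by
  obtain ⟨m, rfl⟩ := Nat.exists_eq_add_of_le' hn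
  obtain ⟨t, rfl⟩ := Nat.exists_eq_add_of_lt hr
  have h1 : (m + 1 + 1).choose 2 * 2 = (m + 2) * (m + 1) := by
    rw [Nat.choose_two_right, Nat.div_mul_cancel (Nat.even_mul_pred_self _).two_dvd]
    rfl
  have h2 : (m + 1 - 1) * (m + 1 - 2) / 2 * 2 = m * (m - 1) :=
    Nat.div_mul_cancel (Nat.even_mul_pred_self m).two_dvd
  have h3 : m + 1 + t + 1 - (m + 1) = t + 1 := by lia
  rw [h3, Nat.add_sub_cancel]
  rw [Nat.add_sub_cancel] at h2
  generalize (m + 1 + 1).choose 2 = b at *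
  generalize m * (m + 1 - 2) / 2 = a at *
  have h4 : (m + 1) * (m + 1 + t + 1) = m * (t + 1) + a + (m + 1 + t) + b := by
    rcases m with _ | m
    · simp at h1 h2
      lia
    · simp only [Nat.add_sub_cancel] at h2
      nlinarith
  lia

theorem mainTheorem6 (r n d : ℕ) (hn : 1 ≤ n) (hr : n < r) (hd : 3 ≤ d) :
    Fradeco.zariskiDim (Sym (Fin n) d) (Fradeco.fradecoVariety r n d) ≤
      ((min ((n - 1) * (r - n) + (n - 1) * (n - 2) / 2 + r - 1)
        (Nat.choose (n + d - 1) d - 1) : ℕ) : WithBot ℕ∞) := by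
  have hZ := Fradeco.isProjAlgebraic_fradecoVariety r n d
  rcases min_choice ((n - 1) * (r - n) + (n - 1) * (n - 2) / 2 + r - 1)
    ((n + d - 1).choose d - 1) with h | h <;> rw [h]
  · refine (Fradeco.zariskiDim_le_of_ringKrullDim_quotient_le (fun P hP h => ?_) hZ).trans
      (by exact_mod_cast mul_add_one_sub_choose_sub_one_le hn hr)
    obtain ⟨p, hp, hJ, hle⟩ := Fradeco.exists_prime_comap_tensorHom_le hP h
    exact ⟨_, hle, Fradeco.ringKrullDim_quotient_comap_tensorHom_le hn hr hp hJ⟩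
  · have := Fradeco.zariskiDim_le_projective hZ
    rwa [Nat.card_eq_fintype_card, Sym.card_sym_eq_choose, Fintype.card_fin] at this
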